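/- Setting. Let $M\ge 1$ and let $I=\{1,\dots,M\}$ be a pool of experiments with responses in $\mathbb R^d$. For a true label $\theta\in\{0,1\}$, a response of experiment $\delta\in I$ has probability density or mass function $f_{\theta,\delta}$ with respect to a reference measure $\nu_\delta$ (for example Lebesgue or counting measure). An adaptive sequential design $(J,N,D)$ consists of a selection rule $J=(j_n)_{n\ge1}$, where the $n$-th experiment is $\delta_n=j_n(X_1,\dots,X_{n-1})\in I$ with $j_n$ measurable; a stopping time $N\in\{0,1,2,\dots,\infty\}$ with respect to the $\sigma$-algebras $\mathcal F_n=\sigma(X_1,\dots,X_n)$; and an $\mathcal F_N$-measurable decision $D\in\{0,1\}$. Given $\theta$ and $X_1,\dots,X_{n-1}$, the response $X_n$ has density $f_{\theta,\delta_n}$. Let $\pi_0,\pi_1\ge 0$ with $\pi_0+\pi_1=1$ be the prior probabilities of $\theta=0,1$, let $c\in[0,1]$, and define the Bayes risk $$\mathbf R(J,N,D)=\pi_0\,\mathbb P(D=1\mid\theta=0)+\pi_1\,\mathbb P(D=0\mid\theta=1)+c\{\pi_0\,\mathbb E(N\mid\theta=0)+\pi_1\,\mathbb E(N\mid\theta=1)\}.$$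 For $T\in\mathbb N$ let $\mathcal A^T$ be the set of designs with $N\le T$, and let $\mathcal A^*$ be the set of designs with $\mathbb E(N\mid\theta=0)<\infty$ and $\mathbb E(N\mid\theta=1)<\infty$. Theorem. For every $T$ the minimum of $\mathbf R$ over $\mathcal A^T$ is attained, and $$\lim_{T\to\infty}\ \min_{(J,N,D)\in\mathcal A^T}\mathbf R(J,N,D)=\inf_{(J,N,D)\in\mathcal A^*}\mathbf R(J,N,D).$$ If moreover $c>0$, the infimum over $\mathcal A^*$ is attained, so that $$\lim_{T\to\infty}\ \min_{(J,N,D)\in\mathcal A^T}\mathbf R(J,N,D)=\min_{(J,N,D)\in\mathcal A^*}\mathbf R(J,N,D).$$ -/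

import Mathlib

open MeasureTheory ProbabilityTheory Filter Topology
open scoped ENNReal NNReal

namespace AdaSPRT

/-- Statistical model with `M` experiments and responses in `𝓧`. For experiment `δ` and true label
`θ ∈ {0, 1}`, a response has density `density θ δ` with respect to the reference measure `ref δ`
(e.g. Lebesgue measure, or counting measure for a probability mass function). -/
structure Model (M : ℕ) (𝓧 : Type*) [MeasurableSpace 𝓧] where
  ref : Fin M → Measure 𝓧
  density : Fin 2 → Fin M → 𝓧 → ℝ≥0
  measurable_density : ∀ θ δ, Measurable (density θ δ)
  lintegral_density : ∀ θ δ, ∫⁻ x, (density θ δ x : ℝ≥0∞) ∂(ref δ) = 1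

section

variable {M : ℕ} {𝓧 : Type*} [MeasurableSpace 𝓧]

/-- The law of one response of experiment `δ` when the true label is `θ`. -/
noncomputable def Model.responseLaw (m : Model M 𝓧) (θ : Fin 2) (δ : Fin M) : Measure 𝓧 :=
  (m.ref δ).withDensity fun x => (m.density θ δ x : ℝ≥0∞)

instance (m : Model M 𝓧) (θ : Fin 2) (δ : Fin M) : IsProbabilityMeasure (m.responseLaw θ δ) :=
  ⟨by rw [Model.responseLaw, withDensity_apply _ MeasurableSet.univ, Measure.restrict_univ,
    m.lintegral_density]⟩

/-- The response laws as a Markov kernel from experiments to responses. -/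
noncomputable def Model.responseKernel (m : Model M 𝓧) (θ : Fin 2) : Kernel (Fin M) 𝓧 :=
  Kernel.ofFunOfCountable (m.responseLaw θ)

instance (m : Model M 𝓧) (θ : Fin 2) : IsMarkovKernel (m.responseKernel θ) :=
  ⟨fun δ => inferInstanceAs (IsProbabilityMeasure (m.responseLaw θ δ))⟩

/-- The first `n` responses of a response sequence. The sequence is indexed from `0`, so that
`ω i` is the `(i + 1)`-st response. -/
def firstResponses (n : ℕ) (ω : ℕ → 𝓧) : Fin n → 𝓧 := fun i => ω i

lemma measurable_firstResponses (n : ℕ) : Measurable (firstResponses (𝓧 := 𝓧) n) :=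
  measurable_pi_lambda _ fun i => measurable_pi_apply (i : ℕ)

variable (𝓧) in
/-- The filtration of the observations: the σ-algebra at time `n` is generated by the first `n`
responses (so it is trivial at time `0`). -/
def obsFiltration : Filtration ℕ (inferInstance : MeasurableSpace (ℕ → 𝓧)) where
  seq n := MeasurableSpace.comap (firstResponses n) inferInstance
  mono' := by
    intro a b hab
    have h : firstResponses (𝓧 := 𝓧) a = (fun y i => y (Fin.castLE hab i)) ∘ firstResponses b :=
      rfl
    change MeasurableSpace.comap _ _ ≤ MeasurableSpace.comap _ _
    rw [h, ← MeasurableSpace.comap_comp]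
    exact MeasurableSpace.comap_mono
      (measurable_pi_lambda _ fun i => measurable_pi_apply _).comap_le
  le' n := (measurable_firstResponses n).comap_le

variable (M 𝓧) in
/-- An adaptive sequential design `(J, N, D)`. The experiment producing the `(n + 1)`-st response is
a measurable function `select n` of the first `n` responses, the sample size is a stopping time of
the observations with values in `{0, 1, 2, …, ∞}`, and the decision between the two hypotheses is
determined by the observations up to that stopping time. -/
structure Design where
  select : (n : ℕ) → (Fin n → 𝓧) → Fin M
  measurable_select : ∀ n, Measurable (select n)
  sampleSize : (ℕ → 𝓧) → ℕ∞
  isStoppingTime : IsStoppingTime (obsFiltration 𝓧) sampleSize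
  decision : (ℕ → 𝓧) → Fin 2
  measurable_decision : Measurable[isStoppingTime.measurableSpace] decision

/-- The conditional law of the response with index `n + 1`, given those with indices `0, …, n`. -/
noncomputable def Design.stepKernel (d : Design M 𝓧) (m : Model M 𝓧) (θ : Fin 2) (n : ℕ) :
    Kernel ((i : Finset.Iic n) → 𝓧) 𝓧 :=
  (m.responseKernel θ).comap
    (fun x => d.select (n + 1) fun i : Fin (n + 1) =>
      x ⟨i, Finset.mem_Iic.2 (Nat.lt_succ_iff.1 i.isLt)⟩)
    ((d.measurable_select (n + 1)).comp
      (measurable_pi_lambda _ fun _ => measurable_pi_apply _))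

instance (d : Design M 𝓧) (m : Model M 𝓧) (θ : Fin 2) (n : ℕ) :
    IsMarkovKernel (d.stepKernel m θ n) := by
  unfold Design.stepKernel; infer_instance

/-- The law of the whole response sequence under the design `d` when the true label is `θ`: the
first response follows the law of the first selected experiment, and each later response follows
the law of the experiment selected from the preceding responses. -/
noncomputable def Design.law (d : Design M 𝓧) (m : Model M 𝓧) (θ : Fin 2) : Measure (ℕ → 𝓧) :=
  Kernel.trajMeasure (X := fun _ => 𝓧) (m.responseLaw θ (d.select 0 Fin.elim0)) (d.stepKernel m θ)

/-- `E(N | θ)`. -/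
noncomputable def Design.meanSampleSize (d : Design M 𝓧) (m : Model M 𝓧) (θ : Fin 2) : ℝ≥0∞ :=
  ∫⁻ ω, (d.sampleSize ω : ℝ≥0∞) ∂(d.law m θ)

/-- The Bayes risk
`π₀ P(D = 1 | θ = 0) + π₁ P(D = 0 | θ = 1) + c (π₀ E(N | θ = 0) + π₁ E(N | θ = 1))`. -/
noncomputable def designRisk (m : Model M 𝓧) (π₀ π₁ c : ℝ) (d : Design M 𝓧) : ℝ≥0∞ :=
  ENNReal.ofReal π₀ * d.law m 0 {ω | d.decision ω = 1}
    + ENNReal.ofReal π₁ * d.law m 1 {ω | d.decision ω = 0}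
    + ENNReal.ofReal c * (ENNReal.ofReal π₀ * d.meanSampleSize m 0
        + ENNReal.ofReal π₁ * d.meanSampleSize m 1)

variable (M 𝓧) in
/-- The designs truncated at horizon `T`, i.e. those with `N ≤ T`. -/
def truncatedDesigns (T : ℕ) : Set (Design M 𝓧) :=
  {d | ∀ ω, d.sampleSize ω ≤ (T : ℕ∞)}

/-- The designs whose expected sample size is finite under both hypotheses. -/
def finiteMeanDesigns (m : Model M 𝓧) : Set (Design M 𝓧) :=
  {d | ∀ θ, d.meanSampleSize m θ < ∞}

end

end AdaSPRT

/-! The problem is optimal stopping and control of a Markov state. Each response law has a density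
with respect to the equal mixture of the laws under the two labels, so the prior weight times the
likelihood ratio gives an unnormalised posterior `u`. On events of the first `n` responses,
integrals under either label become integrals of `u` under one mixture law
(`Design.mul_lintegral_law`). The risk then splits into stage losses: `min (u 0) (u 1)` on stopping
and `c * (u 0 + u 1)` per observation.

Let `V_T` be the value with at most `T` observations left and `V = ⨅ T, V_T`. Monotone convergence
shows that `V` satisfies the optimality equation (`Model.value_le_continueLoss`,
`Model.min_le_value`). Telescoping the stage losses along a design gives two verification bounds. A
subsolution lies below the risk when `N < ∞` almost surely under label 0 (`Design.le_risk`), and a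
supersolution bounds the stage losses of the policy that it induces (`Design.tsum_stageLoss_le`).
Hence `V_T` is the minimum over `N ≤ T` and `V` is the infimum over finite-mean designs. If `c > 0`
and both priors are positive, the second bound forces the policy induced by `V` to have finite
means, so it attains `V`. If a prior vanishes, stopping at once costs nothing. -/

namespace AdaSPRT

section

variable {M : ℕ} {𝓧 : Type*} [MeasurableSpace 𝓧]

/-! ### Mixture model and likelihood ratios -/

/-- The model in which, whatever the label, responses follow the equal mixture of the two response
laws. -/
noncomputable def Model.mixture (m : Model M 𝓧) : Model M 𝓧 where
  ref := m.ref
  density _ δ x := 2⁻¹ * (m.density 0 δ x + m.density 1 δ x)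
  measurable_density _ δ :=
    measurable_const.mul ((m.measurable_density 0 δ).add (m.measurable_density 1 δ))
  lintegral_density _ δ := by
    simp only [ENNReal.coe_mul, ENNReal.coe_add]
    rw [lintegral_const_mul _ (by have := m.measurable_density; fun_prop),
      lintegral_add_left (m.measurable_density 0 δ).coe_nnreal_ennreal, m.lintegral_density,
      m.lintegral_density, ENNReal.coe_inv two_ne_zero, one_add_one_eq_two]
    exact ENNReal.inv_mul_cancel two_ne_zero ENNReal.ofNat_ne_top

/-- The density of the response law with respect to the mixture of the two response laws. -/
noncomputable def Model.relDensity (m : Model M 𝓧) (θ : Fin 2) (δ : Fin M) (x : 𝓧) : ℝ≥0 :=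
  m.density θ δ x / (2⁻¹ * (m.density 0 δ x + m.density 1 δ x))

lemma Model.measurable_relDensity (m : Model M 𝓧) (θ : Fin 2) (δ : Fin M) :
    Measurable (m.relDensity θ δ) :=
  (m.measurable_density θ δ).div (m.mixture.measurable_density 0 δ)

lemma Model.measurable_relDensity_uncurry (m : Model M 𝓧) (θ : Fin 2) :
    Measurable fun p : Fin M × 𝓧 => m.relDensity θ p.1 p.2 :=
  measurable_from_prod_countable_right fun δ => m.measurable_relDensity θ δ

lemma Model.responseLaw_eq_withDensity (m : Model M 𝓧) (θ : Fin 2) (δ : Fin M) :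
    m.responseLaw θ δ =
      (m.mixture.responseLaw 0 δ).withDensity fun x => (m.relDensity θ δ x : ℝ≥0∞) := by
  rw [Model.responseLaw, Model.responseLaw, ← withDensity_mul _
    (m.mixture.measurable_density 0 δ).coe_nnreal_ennreal
    (m.measurable_relDensity θ δ).coe_nnreal_ennreal]
  congr 1
  funext x
  simp only [Pi.mul_apply, ← ENNReal.coe_mul, ENNReal.coe_inj, Model.relDensity, Model.mixture]
  -- The convention `a / 0 = 0` is harmless: where the mixture density vanishes, so do both
  -- densities.
  by_cases h : 2⁻¹ * (m.density 0 δ x + m.density 1 δ x) = 0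
  · have h' : m.density 0 δ x = 0 ∧ m.density 1 δ x = 0 := by simpa using h
    rw [h, zero_mul]
    fin_cases θ
    exacts [h'.1, h'.2]
  · rw [mul_div_cancel₀ _ h]

/-- The unnormalised posterior after observing `x` from experiment `δ`. -/
noncomputable def Model.nextState (m : Model M 𝓧) (u : Fin 2 → ℝ≥0) (δ : Fin M) (x : 𝓧) :
    Fin 2 → ℝ≥0 :=
  fun θ => u θ * m.relDensity θ δ x

lemma Model.measurable_nextState (m : Model M 𝓧) :
    Measurable fun p : ((Fin 2 → ℝ≥0) × Fin M) × 𝓧 => m.nextState p.1.1 p.1.2 p.2 := by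
  refine measurable_pi_lambda _ fun θ => ?_
  exact ((measurable_pi_apply θ).comp (measurable_fst.comp measurable_fst)).mul
    ((m.measurable_relDensity_uncurry θ).comp
      ((measurable_snd.comp measurable_fst).prodMk measurable_snd))

/-- The unnormalised posterior is a martingale under the mixture law. The finiteness of this
integral permits monotone convergence from above in `Model.value_le_continueLoss`. -/
lemma Model.lintegral_nextState (m : Model M 𝓧) (u : Fin 2 → ℝ≥0) (δ : Fin M) (θ : Fin 2) :
    ∫⁻ x, (m.nextState u δ x θ : ℝ≥0∞) ∂(m.mixture.responseLaw 0 δ) = u θ := by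
  have h : ∫⁻ x, (m.relDensity θ δ x : ℝ≥0∞) ∂(m.mixture.responseLaw 0 δ) = 1 := by
    rw [← setLIntegral_univ, ← withDensity_apply _ MeasurableSet.univ,
      ← m.responseLaw_eq_withDensity, measure_univ]
  simp only [Model.nextState, ENNReal.coe_mul]
  rw [lintegral_const_mul _ (m.measurable_relDensity θ δ).coe_nnreal_ennreal, h, mul_one]

/-! ### Laws of the response sequence and change of measure -/

instance (d : Design M 𝓧) (m : Model M 𝓧) (θ : Fin 2) : IsProbabilityMeasure (d.law m θ) := by
  unfold Design.law; infer_instance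

/-- The conditional law of the response with index `n`, given those with indices below `n`. -/
noncomputable def Design.responseKernel (d : Design M 𝓧) (m : Model M 𝓧) (θ : Fin 2) (n : ℕ) :
    Kernel (Fin n → 𝓧) 𝓧 :=
  (m.responseKernel θ).comap (d.select n) (d.measurable_select n)

instance (d : Design M 𝓧) (m : Model M 𝓧) (θ : Fin 2) (n : ℕ) :
    IsMarkovKernel (d.responseKernel m θ n) := by
  unfold Design.responseKernel; infer_instance

lemma Design.responseKernel_apply (d : Design M 𝓧) (m : Model M 𝓧) (θ : Fin 2) (n : ℕ)
    (y : Fin n → 𝓧) : d.responseKernel m θ n y = m.responseLaw θ (d.select n y) := rfl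

/-- Integrating out the response with index `n`, given those with indices below `n`. -/
lemma Design.lintegral_law_response (d : Design M 𝓧) (m : Model M 𝓧) (θ : Fin 2) (n : ℕ)
    {f : (Fin n → 𝓧) × 𝓧 → ℝ≥0∞} (hf : Measurable f) :
    ∫⁻ ω, f (firstResponses n ω, ω n) ∂(d.law m θ) =
      ∫⁻ ω, ∫⁻ x, f (firstResponses n ω, x) ∂(m.responseLaw θ (d.select n (firstResponses n ω)))
        ∂(d.law m θ) := by
  -- The first response comes from the initial measure of `trajMeasure`, all later ones from the
  -- step kernels.
  cases n with
  | zero =>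
    have h0 : (d.law m θ).map (fun ω => ω 0) = m.responseLaw θ (d.select 0 Fin.elim0) := by
      rw [Design.law, Kernel.trajMeasure, Measure.map_comp _ _ (measurable_pi_apply _)]
      have : (Kernel.traj (d.stepKernel m θ) 0).map (fun ω : ℕ → 𝓧 => ω 0) =
          Kernel.deterministic (fun x : Finset.Iic 0 → 𝓧 => x ⟨0, by simp⟩)
            (measurable_pi_apply _) := by
        have h1 : (fun ω : ℕ → 𝓧 => ω 0) =
            (fun x : Finset.Iic 0 → 𝓧 => x ⟨0, by simp⟩) ∘ Preorder.frestrictLe 0 := rfl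
        rw [h1, Kernel.map_comp_right _ (Preorder.measurable_frestrictLe 0) (by fun_prop), Kernel.traj_map_frestrictLe,
          Kernel.partialTraj_self, Kernel.id_map (by fun_prop)]
      rw [this, Measure.deterministic_comp_eq_map, Measure.map_map (by fun_prop) (by fun_prop)]
      exact Measure.map_id
    have h1 : ∀ ω : ℕ → 𝓧, firstResponses 0 ω = Fin.elim0 := fun ω => Subsingleton.elim _ _
    simp only [h1, lintegral_const, measure_univ, mul_one]
    rw [← h0]
    exact (lintegral_map (f := fun x => f (Fin.elim0, x)) (hf.comp measurable_prodMk_left)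
      (measurable_pi_apply 0)).symm
  | succ n =>
    let e : (Finset.Iic n → 𝓧) → (Fin (n + 1) → 𝓧) := fun x i =>
      x ⟨i, Finset.mem_Iic.2 (Nat.lt_succ_iff.1 i.isLt)⟩
    have he : Measurable e := measurable_pi_lambda _ fun _ => measurable_pi_apply _
    have key := Kernel.map_frestrictLe_trajMeasure_compProd_eq_map_trajMeasure
      (X := fun _ => 𝓧) (μ₀ := m.responseLaw θ (d.select 0 Fin.elim0))
      (κ := d.stepKernel m θ) (a := n)
    have hF : Measurable fun p : (Finset.Iic n → 𝓧) × 𝓧 => f (e p.1, p.2) :=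
      hf.comp ((he.comp measurable_fst).prodMk measurable_snd)
    have h2 := congrArg (fun μ => ∫⁻ p, f (e p.1, p.2) ∂μ) key
    rw [Measure.lintegral_compProd hF, lintegral_map hF (by fun_prop),
      lintegral_map hF.lintegral_kernel_prod_right' (by fun_prop)] at h2
    exact h2.symm

/-- The unnormalised posterior given the first `n` responses. -/
noncomputable def Design.state (d : Design M 𝓧) (m : Model M 𝓧) (p : Fin 2 → ℝ≥0) :
    (n : ℕ) → (Fin n → 𝓧) → Fin 2 → ℝ≥0
  | 0, _ => p
  | n + 1, y => m.nextState (d.state m p n fun i => y i.castSucc)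
      (d.select n fun i => y i.castSucc) (y (Fin.last n))

lemma Design.state_succ_firstResponses (d : Design M 𝓧) (m : Model M 𝓧) (p : Fin 2 → ℝ≥0) (n : ℕ)
    (ω : ℕ → 𝓧) : d.state m p (n + 1) (firstResponses (n + 1) ω) =
      m.nextState (d.state m p n (firstResponses n ω)) (d.select n (firstResponses n ω)) (ω n) :=
  rfl

lemma Design.measurable_state (d : Design M 𝓧) (m : Model M 𝓧) (p : Fin 2 → ℝ≥0) (n : ℕ) :
    Measurable (d.state m p n) := by
  induction n with
  | zero => exact measurable_const
  | succ n ih =>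
    have h : Measurable fun (y : Fin (n + 1) → 𝓧) (i : Fin n) => y i.castSucc :=
      measurable_pi_lambda _ fun _ => measurable_pi_apply _
    exact m.measurable_nextState.comp
      (((ih.comp h).prodMk ((d.measurable_select n).comp h)).prodMk (measurable_pi_apply _))

/-- Change of measure: the posterior state is the likelihood with respect to the mixture law. -/
lemma Design.mul_lintegral_law (d : Design M 𝓧) (m : Model M 𝓧) (p : Fin 2 → ℝ≥0) (θ : Fin 2)
    (n : ℕ) {f : (Fin n → 𝓧) → ℝ≥0∞} (hf : Measurable f) :
    p θ * ∫⁻ ω, f (firstResponses n ω) ∂(d.law m θ) =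
      ∫⁻ ω, d.state m p n (firstResponses n ω) θ * f (firstResponses n ω)
        ∂(d.law m.mixture 0) := by
  induction n with
  | zero =>
    have h1 : ∀ ω : ℕ → 𝓧, firstResponses 0 ω = Fin.elim0 := fun ω => Subsingleton.elim _ _
    simp [h1, Design.state]
  | succ n ih =>
    have hsnoc : Measurable fun q : (Fin n → 𝓧) × 𝓧 =>
        (Fin.snoc (α := fun _ => 𝓧) q.1 q.2 : Fin (n + 1) → 𝓧) := by
      refine measurable_pi_lambda _ fun i => ?_
      refine Fin.lastCases ?_ (fun j => ?_) i
      · simpa using measurable_snd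
      · simpa [Function.comp_def] using
          (measurable_pi_apply j).comp (measurable_fst (α := Fin n → 𝓧) (β := 𝓧))
    have hG := hf.comp hsnoc
    have hfr : ∀ ω : ℕ → 𝓧, firstResponses (n + 1) ω =
        Fin.snoc (α := fun _ => 𝓧) (firstResponses n ω) (ω n) := fun ω => by
      funext i
      refine Fin.lastCases ?_ (fun j => ?_) i
      · simp [firstResponses]
      · simp [firstResponses]
    have hst : Measurable fun q : (Fin n → 𝓧) × 𝓧 =>
        (m.nextState (d.state m p n q.1) (d.select n q.1) q.2 θ : ℝ≥0∞) :=
      ((measurable_pi_apply θ).comp (m.measurable_nextState.comp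
        ((((d.measurable_state m p n).comp measurable_fst).prodMk
          ((d.measurable_select n).comp measurable_fst)).prodMk
            measurable_snd))).coe_nnreal_ennreal
    have hH : Measurable fun q : (Fin n → 𝓧) × 𝓧 =>
        (m.nextState (d.state m p n q.1) (d.select n q.1) q.2 θ : ℝ≥0∞) *
          f (Fin.snoc (α := fun _ => 𝓧) q.1 q.2) := hst.mul hG
    have e1 := d.lintegral_law_response m θ n hG
    have e2 := d.lintegral_law_response m.mixture 0 n hH
    simp only [Function.comp_apply] at e1
    simp only [d.state_succ_firstResponses]
    simp only [hfr]
    rw [e1, e2]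
    -- The last response is integrated out before the induction hypothesis is applied; the remaining
    -- change of its law contributes exactly the factor `relDensity` by which `nextState` updates
    -- the posterior.
    have := ih (f := fun y => ∫⁻ x, f (Fin.snoc (α := fun _ => 𝓧) y x)
      ∂(d.responseKernel m θ n y)) hG.lintegral_kernel_prod_right'
    simp only [Design.responseKernel_apply] at this
    rw [this]
    refine lintegral_congr fun ω => ?_
    have hy : Measurable fun x => f (Fin.snoc (α := fun _ => 𝓧) (firstResponses n ω) x) :=
      hG.comp measurable_prodMk_left
    have hr := (m.measurable_relDensity θ
      (d.select n (firstResponses n ω))).coe_nnreal_ennreal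
    rw [m.responseLaw_eq_withDensity, lintegral_withDensity_eq_lintegral_mul _ hr hy,
      ← lintegral_const_mul _ (hr.mul hy)]
    refine lintegral_congr fun x => ?_
    simp only [Model.nextState, ENNReal.coe_mul, Pi.mul_apply, mul_assoc]

lemma measurable_firstResponses_obsFiltration (n : ℕ) :
    Measurable[obsFiltration 𝓧 n] (firstResponses (𝓧 := 𝓧) n) :=
  comap_measurable _

lemma Design.mul_law_apply (d : Design M 𝓧) (m : Model M 𝓧) (p : Fin 2 → ℝ≥0) (θ : Fin 2)
    (n : ℕ) {s : Set (ℕ → 𝓧)} (hs : MeasurableSet[obsFiltration 𝓧 n] s) :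
    p θ * d.law m θ s =
      ∫⁻ ω in s, d.state m p n (firstResponses n ω) θ ∂(d.law m.mixture 0) := by
  obtain ⟨t, ht, rfl⟩ := hs
  have hs : MeasurableSet (firstResponses n ⁻¹' t) := measurable_firstResponses n ht
  have := d.mul_lintegral_law m p θ n (f := t.indicator 1) (measurable_one.indicator ht)
  rw [← lintegral_indicator hs]
  rw [← lintegral_indicator_one hs]
  refine this.trans (lintegral_congr fun ω => ?_)
  by_cases h : firstResponses n ω ∈ t <;> simp [h]

/-- Integrating out the response with index `n` in the posterior state, on an event determined by
the preceding responses. -/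
lemma Design.setLIntegral_state_succ (d : Design M 𝓧) (m : Model M 𝓧) (p : Fin 2 → ℝ≥0)
    (n : ℕ) {s : Set (ℕ → 𝓧)} (hs : MeasurableSet[obsFiltration 𝓧 n] s)
    {W : (Fin 2 → ℝ≥0) → ℝ≥0∞} (hW : Measurable W) :
    ∫⁻ ω in s, W (d.state m p (n + 1) (firstResponses (n + 1) ω)) ∂(d.law m.mixture 0) =
      ∫⁻ ω in s, ∫⁻ x, W (m.nextState (d.state m p n (firstResponses n ω))
        (d.select n (firstResponses n ω)) x)
          ∂(m.mixture.responseLaw 0 (d.select n (firstResponses n ω))) ∂(d.law m.mixture 0) := by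
  obtain ⟨t, ht, rfl⟩ := hs
  have hs : MeasurableSet (firstResponses n ⁻¹' t) := measurable_firstResponses n ht
  have hG : Measurable fun q : (Fin n → 𝓧) × 𝓧 =>
      W (m.nextState (d.state m p n q.1) (d.select n q.1) q.2) :=
    hW.comp (m.measurable_nextState.comp
      ((((d.measurable_state m p n).comp measurable_fst).prodMk
        ((d.measurable_select n).comp measurable_fst)).prodMk measurable_snd))
  have h := d.lintegral_law_response m.mixture 0 n (hG.indicator (measurable_fst ht))
  rw [← lintegral_indicator hs, ← lintegral_indicator hs]
  refine (Eq.trans ?_ h).trans ?_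
  · refine lintegral_congr fun ω => ?_
    by_cases hω : firstResponses n ω ∈ t <;> simp [hω, d.state_succ_firstResponses]
  · refine lintegral_congr fun ω => ?_
    by_cases hω : firstResponses n ω ∈ t <;> simp [hω]

/-! ### Value functions and the optimality equation -/

/-- The Bayes loss of deciding immediately. -/
noncomputable def stopLoss (u : Fin 2 → ℝ≥0) : ℝ≥0∞ := min (u 0 : ℝ≥0∞) (u 1)

lemma measurable_stopLoss : Measurable stopLoss :=
  (measurable_pi_apply 0).coe_nnreal_ennreal.min (measurable_pi_apply 1).coe_nnreal_ennreal

/-- The loss of taking one more observation, from experiment `δ`, with subsequent loss `W`. -/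
noncomputable def Model.continueLoss (m : Model M 𝓧) (c : ℝ≥0∞) (W : (Fin 2 → ℝ≥0) → ℝ≥0∞)
    (δ : Fin M) (u : Fin 2 → ℝ≥0) : ℝ≥0∞ :=
  c * (u 0 + u 1) + ∫⁻ x, W (m.nextState u δ x) ∂(m.mixture.responseLaw 0 δ)

lemma Model.measurable_continueLoss (m : Model M 𝓧) (c : ℝ≥0∞) {W : (Fin 2 → ℝ≥0) → ℝ≥0∞}
    (hW : Measurable W) (δ : Fin M) : Measurable (m.continueLoss c W δ) := by
  have h : Measurable fun p : (Fin 2 → ℝ≥0) × 𝓧 => W (m.nextState p.1 δ p.2) :=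
    hW.comp (m.measurable_nextState.comp
      ((measurable_fst.prodMk measurable_const).prodMk measurable_snd))
  refine Measurable.add ?_ h.lintegral_prod_right'
  exact measurable_const.mul ((measurable_pi_apply 0).coe_nnreal_ennreal.add
    (measurable_pi_apply 1).coe_nnreal_ennreal)

lemma Model.continueLoss_mono (m : Model M 𝓧) (c : ℝ≥0∞) {W W' : (Fin 2 → ℝ≥0) → ℝ≥0∞}
    (h : W ≤ W') (δ : Fin M) (u : Fin 2 → ℝ≥0) :
    m.continueLoss c W δ u ≤ m.continueLoss c W' δ u :=
  add_le_add le_rfl (lintegral_mono fun _ => h _)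

/-- The minimal Bayes loss when at most `T` further observations may be taken. -/
noncomputable def Model.truncatedValue (m : Model M 𝓧) (c : ℝ≥0∞) :
    ℕ → (Fin 2 → ℝ≥0) → ℝ≥0∞
  | 0 => stopLoss
  | T + 1 => fun u => min (stopLoss u) (⨅ δ, m.continueLoss c (m.truncatedValue c T) δ u)

/-- The minimal Bayes loss with an unrestricted number of observations. -/
noncomputable def Model.value (m : Model M 𝓧) (c : ℝ≥0∞) (u : Fin 2 → ℝ≥0) : ℝ≥0∞ :=
  ⨅ T, m.truncatedValue c T u

lemma Model.measurable_truncatedValue (m : Model M 𝓧) (c : ℝ≥0∞) (T : ℕ) :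
    Measurable (m.truncatedValue c T) := by
  induction T with
  | zero => exact measurable_stopLoss
  | succ T ih =>
    exact measurable_stopLoss.min (.iInf fun δ => m.measurable_continueLoss c ih δ)

lemma Model.measurable_value (m : Model M 𝓧) (c : ℝ≥0∞) : Measurable (m.value c) :=
  .iInf fun T => m.measurable_truncatedValue c T

lemma Model.truncatedValue_antitone (m : Model M 𝓧) (c : ℝ≥0∞) :
    Antitone (m.truncatedValue c) := by
  refine antitone_nat_of_succ_le fun T => ?_
  induction T with
  | zero => exact fun u => min_le_left _ _
  | succ T ih =>
    exact fun u => min_le_min le_rfl (iInf_mono fun δ => m.continueLoss_mono c ih δ u)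

lemma Model.truncatedValue_le_stopLoss (m : Model M 𝓧) (c : ℝ≥0∞) (T : ℕ) (u : Fin 2 → ℝ≥0) :
    m.truncatedValue c T u ≤ stopLoss u :=
  m.truncatedValue_antitone c (Nat.zero_le T) u

lemma Model.value_le_stopLoss (m : Model M 𝓧) (c : ℝ≥0∞) (u : Fin 2 → ℝ≥0) :
    m.value c u ≤ stopLoss u :=
  iInf_le _ 0

/-- The values decrease in the horizon and the first has finite integral, so the infimum over
horizons passes through the integral. This makes `value` a subsolution. -/
lemma Model.value_le_continueLoss (m : Model M 𝓧) (c : ℝ≥0∞) (δ : Fin M) (u : Fin 2 → ℝ≥0) :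
    m.value c u ≤ m.continueLoss c (m.value c) δ u := by
  have hx : Measurable fun x => m.nextState u δ x :=
    m.measurable_nextState.comp ((measurable_const (a := (u, δ))).prodMk measurable_id)
  have hfin : ∫⁻ x, m.truncatedValue c 0 (m.nextState u δ x) ∂(m.mixture.responseLaw 0 δ) ≠ ∞ := by
    refine ((lintegral_mono fun x => min_le_left _ _).trans_lt
      ((m.lintegral_nextState u δ 0).trans_lt ENNReal.coe_lt_top)).ne
  have h : m.continueLoss c (m.value c) δ u =
      ⨅ T, m.continueLoss c (m.truncatedValue c T) δ u := by
    simp only [Model.continueLoss, Model.value]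
    rw [lintegral_iInf (f := fun T x => m.truncatedValue c T (m.nextState u δ x))
      (fun T => (m.measurable_truncatedValue c T).comp hx)
      (fun S T hST x => m.truncatedValue_antitone c hST _) hfin, ENNReal.add_iInf]
  rw [h]
  exact le_iInf fun T => (iInf_le _ (T + 1)).trans ((min_le_right _ _).trans (iInf_le _ δ))

/-- The supersolution half needs no limit theorem: `value` lies below every `truncatedValue` inside
the continuation loss. -/
lemma Model.min_le_value (m : Model M 𝓧) (c : ℝ≥0∞) (u : Fin 2 → ℝ≥0) :
    min (stopLoss u) (⨅ δ, m.continueLoss c (m.value c) δ u) ≤ m.value c u := by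
  refine le_iInf fun T => ?_
  cases T with
  | zero => exact min_le_left _ _
  | succ T =>
    exact min_le_min le_rfl
      (iInf_mono fun δ => m.continueLoss_mono c (fun v => iInf_le _ T) δ u)

/-- Candidates are compared one at a time. The induction also carries measurability of the current
minimum, which makes the next comparison set measurable. -/
lemma exists_measurable_argmin {S ι : Type*} [MeasurableSpace S] [Finite ι] [Nonempty ι]
    [MeasurableSpace ι] {F : ι → S → ℝ≥0∞} (hF : ∀ i, Measurable (F i)) :
    ∃ s : S → ι, Measurable s ∧ ∀ u i, F (s u) u ≤ F i u := by
  classical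
  have := Fintype.ofFinite ι
  have h : ∀ t : Finset ι, t.Nonempty →
      ∃ s : S → ι, (Measurable s ∧ Measurable fun u => F (s u) u) ∧
        ∀ u, ∀ i ∈ t, F (s u) u ≤ F i u := by
    intro t ht
    induction ht using Finset.Nonempty.cons_induction with
    | singleton a =>
      exact ⟨fun _ => a, ⟨measurable_const, hF a⟩, fun u i hi => by
        rw [Finset.mem_singleton.1 hi]⟩
    | cons a t _ _ ih =>
      obtain ⟨s, ⟨hs, hFs⟩, hmin⟩ := ih
      have hset : MeasurableSet {u | F a u ≤ F (s u) u} := measurableSet_le (hF a) hFs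
      refine ⟨fun u => if F a u ≤ F (s u) u then a else s u,
        ⟨Measurable.ite hset measurable_const hs, ?_⟩, fun u i hi => ?_⟩
      · have : (fun u => F (if F a u ≤ F (s u) u then a else s u) u) =
            fun u => if F a u ≤ F (s u) u then F a u else F (s u) u := by
          funext u; split_ifs <;> rfl
        rw [this]
        exact Measurable.ite hset (hF a) hFs
      · dsimp only
        rcases Finset.mem_cons.1 hi with rfl | hi
        · split_ifs with h
          exacts [le_rfl, (not_le.1 h).le]
        · split_ifs with h
          exacts [h.trans (hmin u i hi), hmin u i hi]
  obtain ⟨s, ⟨hs, -⟩, hmin⟩ := h Finset.univ Finset.univ_nonempty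
  exact ⟨s, hs, fun u i => hmin u i (Finset.mem_univ i)⟩

/-! ### Decomposition of the risk into stage losses -/

/-- The Bayes risk with prior weights `p`. -/
noncomputable def Design.risk (d : Design M 𝓧) (m : Model M 𝓧) (p : Fin 2 → ℝ≥0) (c : ℝ≥0∞) :
    ℝ≥0∞ :=
  p 0 * d.law m 0 {ω | d.decision ω = 1} + p 1 * d.law m 1 {ω | d.decision ω = 0}
    + c * (p 0 * d.meanSampleSize m 0 + p 1 * d.meanSampleSize m 1)

/-- The contribution to the Bayes risk of stopping with sample size `n` and of taking the
observation with index `n`, when decisions are optimal. -/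
noncomputable def Design.stageLoss (d : Design M 𝓧) (m : Model M 𝓧) (p : Fin 2 → ℝ≥0) (c : ℝ≥0∞)
    (n : ℕ) : ℝ≥0∞ :=
  ∫⁻ ω in {ω | d.sampleSize ω = n}, stopLoss (d.state m p n (firstResponses n ω))
      ∂(d.law m.mixture 0) +
    c * ∫⁻ ω in {ω | (n : ℕ∞) < d.sampleSize ω},
      ((d.state m p n (firstResponses n ω) 0 : ℝ≥0∞) + d.state m p n (firstResponses n ω) 1)
        ∂(d.law m.mixture 0)

lemma Design.measurableSet_sampleSize_eq (d : Design M 𝓧) (n : ℕ) :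
    MeasurableSet[obsFiltration 𝓧 n] {ω | d.sampleSize ω = n} :=
  d.isStoppingTime.measurableSet_eq n

lemma Design.measurableSet_lt_sampleSize (d : Design M 𝓧) (n : ℕ) :
    MeasurableSet[obsFiltration 𝓧 n] {ω | (n : ℕ∞) < d.sampleSize ω} :=
  d.isStoppingTime.measurableSet_gt n

lemma Design.measurableSet_decision_inter (d : Design M 𝓧) (i : Fin 2) (n : ℕ) :
    MeasurableSet[obsFiltration 𝓧 n] ({ω | d.decision ω = i} ∩ {ω | d.sampleSize ω = n}) := by
  -- Measurability at the stopping time puts `{D = i} ∩ {N ≤ n}` in the σ-algebra at time `n`.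
  have h1 := (d.measurable_decision (measurableSet_singleton i)).2 n
  have h2 := h1.inter (d.measurableSet_sampleSize_eq n)
  convert! h2 using 1
  ext ω
  simp only [Set.mem_inter_iff, Set.mem_ofPred_eq, Set.mem_preimage, Set.mem_singleton_iff]
  constructor
  · rintro ⟨h, h'⟩
    exact ⟨⟨h, h'.le⟩, h'⟩
  · rintro ⟨⟨h, -⟩, h'⟩
    exact ⟨h, h'⟩

lemma Design.measurable_posterior (d : Design M 𝓧) (m : Model M 𝓧) (p : Fin 2 → ℝ≥0) (n : ℕ) :
    Measurable fun ω => d.state m p n (firstResponses n ω) :=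
  (d.measurable_state m p n).comp (measurable_firstResponses n)

lemma tsum_indicator_lt_eq (N : ℕ∞) :
    ∑' n : ℕ, {n : ℕ | (n : ℕ∞) < N}.indicator (1 : ℕ → ℝ≥0∞) n = (N : ℝ≥0∞) := by
  rw [← tsum_subtype]
  simp only [Pi.one_apply, ENNReal.tsum_one]
  congr 1
  induction N using ENat.recTopCoe with
  | top => simp
  | coe k => simp

lemma Design.meanSampleSize_eq_tsum (d : Design M 𝓧) (m : Model M 𝓧) (θ : Fin 2) :
    d.meanSampleSize m θ = ∑' n : ℕ, d.law m θ {ω | (n : ℕ∞) < d.sampleSize ω} := by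
  have hs : ∀ n : ℕ, MeasurableSet {ω | (n : ℕ∞) < d.sampleSize ω} := fun n =>
    (obsFiltration 𝓧).le n _ (d.measurableSet_lt_sampleSize n)
  simp only [← lintegral_indicator_one (hs _)]
  rw [← lintegral_tsum fun n => (measurable_one.indicator (hs n)).aemeasurable,
    Design.meanSampleSize]
  exact lintegral_congr fun ω => (tsum_indicator_lt_eq (d.sampleSize ω)).symm

lemma Design.mul_meanSampleSize_eq_tsum (d : Design M 𝓧) (m : Model M 𝓧) (p : Fin 2 → ℝ≥0) :
    p 0 * d.meanSampleSize m 0 + p 1 * d.meanSampleSize m 1 =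
      ∑' n : ℕ, ∫⁻ ω in {ω | (n : ℕ∞) < d.sampleSize ω},
        ((d.state m p n (firstResponses n ω) 0 : ℝ≥0∞) + d.state m p n (firstResponses n ω) 1)
          ∂(d.law m.mixture 0) := by
  rw [d.meanSampleSize_eq_tsum, d.meanSampleSize_eq_tsum, ← ENNReal.tsum_mul_left,
    ← ENNReal.tsum_mul_left, ← ENNReal.tsum_add]
  refine tsum_congr fun n => ?_
  rw [d.mul_law_apply m p 0 n (d.measurableSet_lt_sampleSize n),
    d.mul_law_apply m p 1 n (d.measurableSet_lt_sampleSize n), lintegral_add_left]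
  exact ((measurable_pi_apply 0).comp (d.measurable_posterior m p n)).coe_nnreal_ennreal

lemma Design.mul_law_decision_inter (d : Design M 𝓧) (m : Model M 𝓧) (p : Fin 2 → ℝ≥0)
    (θ i : Fin 2) (n : ℕ) :
    p θ * d.law m θ ({ω | d.decision ω = i} ∩ {ω | d.sampleSize ω = n}) =
      ∫⁻ ω in {ω | d.sampleSize ω = n}, {ω | d.decision ω = i}.indicator
        (fun ω => (d.state m p n (firstResponses n ω) θ : ℝ≥0∞)) ω ∂(d.law m.mixture 0) := by
  have h := d.measurableSet_decision_inter i n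
  have hN := d.measurableSet_sampleSize_eq n
  have hle := (obsFiltration 𝓧).le n
  rw [d.mul_law_apply m p θ n h, ← lintegral_indicator (hle _ h),
    ← lintegral_indicator (hle _ hN)]
  refine lintegral_congr fun ω => ?_
  by_cases h1 : d.decision ω = i <;> by_cases h2 : d.sampleSize ω = n <;> simp [h1, h2]

lemma Design.measurable_indicator_decision (d : Design M 𝓧) (m : Model M 𝓧) (p : Fin 2 → ℝ≥0)
    (θ i : Fin 2) (n : ℕ) : Measurable ({ω | d.decision ω = i}.indicator
        (fun ω => (d.state m p n (firstResponses n ω) θ : ℝ≥0∞))) :=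
  ((measurable_pi_apply θ).comp (d.measurable_posterior m p n)).coe_nnreal_ennreal.indicator
    (d.isStoppingTime.measurableSpace_le _ (d.measurable_decision (measurableSet_singleton i)))

/-- The probability of a wrong decision, given sample size `n`, decomposed over the mixture. -/
lemma Design.error_inter_eq (d : Design M 𝓧) (m : Model M 𝓧) (p : Fin 2 → ℝ≥0) (n : ℕ) :
    p 0 * d.law m 0 ({ω | d.decision ω = 1} ∩ {ω | d.sampleSize ω = n}) +
        p 1 * d.law m 1 ({ω | d.decision ω = 0} ∩ {ω | d.sampleSize ω = n}) =
      ∫⁻ ω in {ω | d.sampleSize ω = n},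
        (if d.decision ω = 1 then (d.state m p n (firstResponses n ω) 0 : ℝ≥0∞)
          else d.state m p n (firstResponses n ω) 1) ∂(d.law m.mixture 0) := by
  rw [d.mul_law_decision_inter, d.mul_law_decision_inter,
    ← lintegral_add_left (d.measurable_indicator_decision m p 0 1 n)]
  refine lintegral_congr fun ω => ?_
  have h : d.decision ω = 0 ∨ d.decision ω = 1 := by omega
  rcases h with h | h <;> simp [Set.indicator, h]

lemma Design.tsum_law_inter_le (d : Design M 𝓧) (m : Model M 𝓧) (θ i : Fin 2) :
    ∑' n : ℕ, d.law m θ ({ω | d.decision ω = i} ∩ {ω | d.sampleSize ω = n}) ≤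
      d.law m θ {ω | d.decision ω = i} := by
  rw [← measure_iUnion]
  · exact measure_mono (Set.iUnion_subset fun n => Set.inter_subset_left)
  · intro a b hab
    refine Set.disjoint_left.2 fun ω ha hb => hab ?_
    exact Nat.cast_injective (R := ℕ∞) (ha.2.symm.trans hb.2)
  · exact fun n => (obsFiltration 𝓧).le n _ (d.measurableSet_decision_inter i n)

lemma Design.law_decision_le_tsum (d : Design M 𝓧) (m : Model M 𝓧) (θ i : Fin 2)
    (h : d.law m θ {ω | d.sampleSize ω = ⊤} = 0) :
    d.law m θ {ω | d.decision ω = i} ≤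
      ∑' n : ℕ, d.law m θ ({ω | d.decision ω = i} ∩ {ω | d.sampleSize ω = n}) := by
  refine (measure_mono (t := {ω | d.sampleSize ω = ⊤} ∪ ⋃ n : ℕ, ({ω | d.decision ω = i} ∩
    {ω | d.sampleSize ω = n})) fun ω hω => ?_).trans ?_
  · by_cases hN : d.sampleSize ω = ⊤
    · exact Or.inl hN
    · obtain ⟨n, hn⟩ := ENat.ne_top_iff_exists.1 hN
      exact Or.inr (Set.mem_iUnion.2 ⟨n, hω, hn.symm⟩)
  · refine (measure_union_le _ _).trans ?_
    rw [h, zero_add]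
    exact measure_iUnion_le _

lemma Design.tsum_stageLoss (d : Design M 𝓧) (m : Model M 𝓧) (p : Fin 2 → ℝ≥0) (c : ℝ≥0∞) :
    ∑' n, d.stageLoss m p c n =
      ∑' n : ℕ, ∫⁻ ω in {ω | d.sampleSize ω = n}, stopLoss (d.state m p n (firstResponses n ω))
        ∂(d.law m.mixture 0) +
      c * (p 0 * d.meanSampleSize m 0 + p 1 * d.meanSampleSize m 1) := by
  simp only [Design.stageLoss]
  rw [ENNReal.tsum_add, ENNReal.tsum_mul_left, d.mul_meanSampleSize_eq_tsum]

/-- No decision beats the Bayes decision at the stopping time, and errors on `{N = ∞}` only add to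
the risk. -/
lemma Design.tsum_stageLoss_le_risk (d : Design M 𝓧) (m : Model M 𝓧) (p : Fin 2 → ℝ≥0)
    (c : ℝ≥0∞) : ∑' n, d.stageLoss m p c n ≤ d.risk m p c := by
  rw [d.tsum_stageLoss, Design.risk]
  gcongr
  refine le_trans ?_ (add_le_add (mul_le_mul_right (d.tsum_law_inter_le m 0 1) _)
    (mul_le_mul_right (d.tsum_law_inter_le m 1 0) _))
  rw [← ENNReal.tsum_mul_left, ← ENNReal.tsum_mul_left, ← ENNReal.tsum_add]
  refine ENNReal.tsum_le_tsum fun n => ?_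
  rw [d.error_inter_eq]
  refine lintegral_mono fun ω => ?_
  dsimp only
  split_ifs
  exacts [min_le_left _ _, min_le_right _ _]

/-- Paths with `N = ∞` count as errors in the risk but belong to no stopping stage, so they must be
null. `hD` is the Bayes decision, with ties going to label 1. -/
lemma Design.risk_le_tsum_stageLoss (d : Design M 𝓧) (m : Model M 𝓧) (p : Fin 2 → ℝ≥0)
    (c : ℝ≥0∞) (hN : ∀ θ, d.law m θ {ω | d.sampleSize ω = ⊤} = 0)
    (hD : ∀ (n : ℕ) ω, d.sampleSize ω = n →
      (d.decision ω = 1 ↔ d.state m p n (firstResponses n ω) 0 ≤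
        d.state m p n (firstResponses n ω) 1)) :
    d.risk m p c ≤ ∑' n, d.stageLoss m p c n := by
  rw [d.tsum_stageLoss, Design.risk]
  gcongr
  refine (add_le_add (mul_le_mul_right (d.law_decision_le_tsum m 0 1 (hN 0)) _)
    (mul_le_mul_right (d.law_decision_le_tsum m 1 0 (hN 1)) _)).trans ?_
  rw [← ENNReal.tsum_mul_left, ← ENNReal.tsum_mul_left, ← ENNReal.tsum_add]
  refine ENNReal.tsum_le_tsum fun n => ?_
  rw [d.error_inter_eq]
  refine setLIntegral_mono' ((obsFiltration 𝓧).le n _ (d.measurableSet_sampleSize_eq n))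
    fun ω hω => ?_
  rw [stopLoss]
  split_ifs with h
  · exact le_min le_rfl (ENNReal.coe_le_coe.2 ((hD n ω hω).1 h))
  · exact le_min (ENNReal.coe_le_coe.2 (not_le.1 (mt (hD n ω hω).2 h)).le) le_rfl

/-! ### Verification inequalities by telescoping -/

lemma Design.measurableSet_le_sampleSize (d : Design M 𝓧) (n : ℕ) :
    MeasurableSet[obsFiltration 𝓧 n] {ω | (n : ℕ∞) ≤ d.sampleSize ω} :=
  d.isStoppingTime.measurableSet_ge n

lemma Design.lintegral_le_sampleSize_eq_add (d : Design M 𝓧) (μ : Measure (ℕ → 𝓧)) (n : ℕ)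
    (f : (ℕ → 𝓧) → ℝ≥0∞) :
    ∫⁻ ω in {ω | (n : ℕ∞) ≤ d.sampleSize ω}, f ω ∂μ =
      ∫⁻ ω in {ω | d.sampleSize ω = n}, f ω ∂μ +
        ∫⁻ ω in {ω | (n : ℕ∞) < d.sampleSize ω}, f ω ∂μ := by
  rw [← lintegral_union ((obsFiltration 𝓧).le n _ (d.measurableSet_lt_sampleSize n))]
  · congr 2
    ext ω
    simp [le_iff_eq_or_lt, eq_comm]
  · exact Set.disjoint_left.2 fun ω h h' => h'.ne h.symm

/-- One step of dynamic programming along a design. -/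
lemma Design.setLIntegral_continueLoss (d : Design M 𝓧) (m : Model M 𝓧) (p : Fin 2 → ℝ≥0)
    (c : ℝ≥0∞) (n : ℕ) {W : (Fin 2 → ℝ≥0) → ℝ≥0∞} (hW : Measurable W) :
    ∫⁻ ω in {ω | (n : ℕ∞) < d.sampleSize ω}, m.continueLoss c W (d.select n (firstResponses n ω))
        (d.state m p n (firstResponses n ω)) ∂(d.law m.mixture 0) =
      c * ∫⁻ ω in {ω | (n : ℕ∞) < d.sampleSize ω},
        ((d.state m p n (firstResponses n ω) 0 : ℝ≥0∞) + d.state m p n (firstResponses n ω) 1)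
          ∂(d.law m.mixture 0) +
      ∫⁻ ω in {ω | ((n + 1 : ℕ) : ℕ∞) ≤ d.sampleSize ω},
        W (d.state m p (n + 1) (firstResponses (n + 1) ω)) ∂(d.law m.mixture 0) := by
  -- Whether the next response is taken is known from the first `n`, so that response can be
  -- integrated out on this event.
  have hset : {ω | ((n + 1 : ℕ) : ℕ∞) ≤ d.sampleSize ω} = {ω | (n : ℕ∞) < d.sampleSize ω} := by
    ext ω
    simp only [Set.mem_ofPred_eq, Nat.cast_add, Nat.cast_one]
    exact ENat.add_one_le_iff (ENat.natCast_ne_top n)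
  have hu := d.measurable_posterior m p n
  have hsum : Measurable fun ω => (d.state m p n (firstResponses n ω) 0 : ℝ≥0∞) +
      d.state m p n (firstResponses n ω) 1 :=
    ((measurable_pi_apply 0).comp hu).coe_nnreal_ennreal.add
      ((measurable_pi_apply 1).comp hu).coe_nnreal_ennreal
  rw [hset, d.setLIntegral_state_succ m p n (d.measurableSet_lt_sampleSize n) hW,
    ← lintegral_const_mul _ hsum, ← lintegral_add_left (hsum.const_mul c)]
  rfl

lemma Design.tendsto_law_le_sampleSize (d : Design M 𝓧) (m : Model M 𝓧) (θ : Fin 2) :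
    Tendsto (fun n : ℕ => d.law m θ {ω | (n : ℕ∞) ≤ d.sampleSize ω}) atTop
      (𝓝 (d.law m θ {ω | d.sampleSize ω = ⊤})) := by
  have hset : {ω | d.sampleSize ω = ⊤} = ⋂ n : ℕ, {ω | (n : ℕ∞) ≤ d.sampleSize ω} := by
    ext ω
    simp only [Set.mem_ofPred_eq, Set.mem_iInter]
    exact ENat.eq_top_iff_forall_ge
  rw [hset]
  refine tendsto_measure_iInter_atTop
    (fun n => ((obsFiltration 𝓧).le n _ (d.measurableSet_le_sampleSize n)).nullMeasurableSet)
    (fun a b hab ω (hω : (b : ℕ∞) ≤ d.sampleSize ω) =>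
      (le_trans (Nat.cast_le.2 hab) hω : (a : ℕ∞) ≤ d.sampleSize ω)) ⟨0, measure_ne_top _ _⟩

/-- A subsolution of the optimality equation bounds the Bayes risk from below. -/
lemma Design.le_risk (d : Design M 𝓧) (m : Model M 𝓧) (p : Fin 2 → ℝ≥0) (c : ℝ≥0∞)
    {W : ℕ → (Fin 2 → ℝ≥0) → ℝ≥0∞} (hW : ∀ n, Measurable (W n))
    (hloss : ∀ n u, W n u ≤ stopLoss u)
    (hcont : ∀ n : ℕ, (∃ ω, (n : ℕ∞) < d.sampleSize ω) →
      ∀ δ u, W n u ≤ m.continueLoss c (W (n + 1)) δ u)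
    (hN : d.law m 0 {ω | d.sampleSize ω = ⊤} = 0) : W 0 p ≤ d.risk m p c := by
  -- `A n` is the loss still to come, as measured by `W n`, on paths not stopped before time `n`.
  let A : ℕ → ℝ≥0∞ := fun n => ∫⁻ ω in {ω | (n : ℕ∞) ≤ d.sampleSize ω},
    W n (d.state m p n (firstResponses n ω)) ∂(d.law m.mixture 0)
  have h0 : A 0 = W 0 p := by simp [A, Design.state]
  have hstep : ∀ n, A n ≤ d.stageLoss m p c n + A (n + 1) := fun n => by
    rw [Design.stageLoss, add_assoc, ← d.setLIntegral_continueLoss m p c n (hW (n + 1))]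
    simp only [A]
    rw [d.lintegral_le_sampleSize_eq_add]
    refine add_le_add (lintegral_mono fun ω => hloss _ _) ?_
    exact setLIntegral_mono' ((obsFiltration 𝓧).le n _ (d.measurableSet_lt_sampleSize n))
      fun ω hω => hcont n ⟨ω, hω⟩ _ _
  have hsum : ∀ k, A 0 ≤ ∑ n ∈ Finset.range k, d.stageLoss m p c n + A k := fun k => by
    induction k with
    | zero => simp
    | succ k ih =>
      rw [Finset.sum_range_succ, add_assoc]
      exact ih.trans (add_le_add le_rfl (hstep k))
  -- Bounding the stopping loss by `u 0` alone turns the remainder into a tail probability under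
  -- label 0, which tends to `P(N = ∞ | θ = 0) = 0`.
  have hA : ∀ k, A k ≤ p 0 * d.law m 0 {ω | (k : ℕ∞) ≤ d.sampleSize ω} := fun k => by
    rw [d.mul_law_apply m p 0 k (d.measurableSet_le_sampleSize k)]
    exact lintegral_mono fun ω => (hloss _ _).trans (min_le_left _ _)
  have hlim : Tendsto (fun k : ℕ => ∑' n, d.stageLoss m p c n +
      p 0 * d.law m 0 {ω | (k : ℕ∞) ≤ d.sampleSize ω}) atTop
      (𝓝 (∑' n, d.stageLoss m p c n + p 0 * 0)) :=
    (ENNReal.Tendsto.const_mul (hN ▸ d.tendsto_law_le_sampleSize m 0)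
      (Or.inr ENNReal.coe_ne_top)).const_add _
  rw [mul_zero, add_zero] at hlim
  rw [← h0]
  exact (ge_of_tendsto' hlim fun k => (hsum k).trans
    (add_le_add (ENNReal.sum_le_tsum _) (hA k))).trans (d.tsum_stageLoss_le_risk m p c)

/-- A design that stops only where a supersolution of the optimality equation equals the stopping
loss, and otherwise selects a minimising experiment, has total stage loss bounded by it. -/
lemma Design.tsum_stageLoss_le (d : Design M 𝓧) (m : Model M 𝓧) (p : Fin 2 → ℝ≥0) (c : ℝ≥0∞)
    {W : ℕ → (Fin 2 → ℝ≥0) → ℝ≥0∞} (hW : ∀ n, Measurable (W n))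
    (hloss : ∀ (n : ℕ) ω, d.sampleSize ω = n →
      stopLoss (d.state m p n (firstResponses n ω)) ≤ W n (d.state m p n (firstResponses n ω)))
    (hcont : ∀ (n : ℕ) ω, (n : ℕ∞) < d.sampleSize ω →
      m.continueLoss c (W (n + 1)) (d.select n (firstResponses n ω))
        (d.state m p n (firstResponses n ω)) ≤ W n (d.state m p n (firstResponses n ω))) :
    ∑' n, d.stageLoss m p c n ≤ W 0 p := by
  let A : ℕ → ℝ≥0∞ := fun n => ∫⁻ ω in {ω | (n : ℕ∞) ≤ d.sampleSize ω},
    W n (d.state m p n (firstResponses n ω)) ∂(d.law m.mixture 0)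
  have h0 : A 0 = W 0 p := by simp [A, Design.state]
  have hstep : ∀ n, d.stageLoss m p c n + A (n + 1) ≤ A n := fun n => by
    rw [Design.stageLoss, add_assoc, ← d.setLIntegral_continueLoss m p c n (hW (n + 1))]
    simp only [A]
    rw [d.lintegral_le_sampleSize_eq_add]
    refine add_le_add ?_ ?_
    · exact setLIntegral_mono' ((obsFiltration 𝓧).le n _ (d.measurableSet_sampleSize_eq n))
        fun ω hω => hloss n ω hω
    · exact setLIntegral_mono' ((obsFiltration 𝓧).le n _ (d.measurableSet_lt_sampleSize n))
        fun ω hω => hcont n ω hω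
  have hsum : ∀ k, ∑ n ∈ Finset.range k, d.stageLoss m p c n + A k ≤ A 0 := fun k => by
    induction k with
    | zero => simp
    | succ k ih =>
      rw [Finset.sum_range_succ, add_assoc]
      exact (add_le_add le_rfl (hstep k)).trans ih
  -- In this direction the remainder is nonnegative and is dropped, so finiteness of `N` is not
  -- needed.
  rw [← h0, ENNReal.tsum_eq_iSup_nat]
  exact iSup_le fun k => le_self_add.trans (hsum k)

/-! ### Designs built from state-dependent policies -/

/-- The posterior state when experiments are selected by the state-dependent rule `s`. -/
noncomputable def Model.policyState (m : Model M 𝓧) (p : Fin 2 → ℝ≥0)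
    (s : ℕ → (Fin 2 → ℝ≥0) → Fin M) : (n : ℕ) → (Fin n → 𝓧) → Fin 2 → ℝ≥0
  | 0, _ => p
  | n + 1, y => m.nextState (m.policyState p s n fun i => y i.castSucc)
      (s n (m.policyState p s n fun i => y i.castSucc)) (y (Fin.last n))

lemma Model.measurable_policyState (m : Model M 𝓧) (p : Fin 2 → ℝ≥0)
    {s : ℕ → (Fin 2 → ℝ≥0) → Fin M} (hs : ∀ n, Measurable (s n)) (n : ℕ) :
    Measurable (m.policyState p s n) := by
  induction n with
  | zero => exact measurable_const
  | succ n ih =>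
    have h : Measurable fun (y : Fin (n + 1) → 𝓧) (i : Fin n) => y i.castSucc :=
      measurable_pi_lambda _ fun _ => measurable_pi_apply _
    exact m.measurable_nextState.comp
      (((ih.comp h).prodMk ((hs n).comp (ih.comp h))).prodMk (measurable_pi_apply _))

open scoped Classical in
/-- The first time at which the state of the policy `s` lies in the stopping region `C`. -/
noncomputable def Model.policySampleSize (m : Model M 𝓧) (p : Fin 2 → ℝ≥0)
    (s : ℕ → (Fin 2 → ℝ≥0) → Fin M) (C : ℕ → Set (Fin 2 → ℝ≥0)) (ω : ℕ → 𝓧) : ℕ∞ :=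
  if h : ∃ n, m.policyState p s n (firstResponses n ω) ∈ C n then (Nat.find h : ℕ∞) else ⊤

lemma Model.policySampleSize_le_iff (m : Model M 𝓧) (p : Fin 2 → ℝ≥0)
    (s : ℕ → (Fin 2 → ℝ≥0) → Fin M) (C : ℕ → Set (Fin 2 → ℝ≥0)) (ω : ℕ → 𝓧) (n : ℕ) :
    m.policySampleSize p s C ω ≤ n ↔
      ∃ k ≤ n, m.policyState p s k (firstResponses k ω) ∈ C k := by
  classical
  unfold Model.policySampleSize
  split_ifs with h
  · rw [Nat.cast_le, Nat.find_le_iff]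
  · simp only [top_le_iff, ENat.natCast_ne_top, false_iff]
    exact fun ⟨k, _, hk⟩ => h ⟨k, hk⟩

lemma Model.mem_of_policySampleSize_eq (m : Model M 𝓧) {p : Fin 2 → ℝ≥0}
    {s : ℕ → (Fin 2 → ℝ≥0) → Fin M} {C : ℕ → Set (Fin 2 → ℝ≥0)} {ω : ℕ → 𝓧} {n : ℕ}
    (h : m.policySampleSize p s C ω = n) : m.policyState p s n (firstResponses n ω) ∈ C n := by
  obtain ⟨k, hk, hC⟩ := (m.policySampleSize_le_iff p s C ω n).1 h.le
  have := (m.policySampleSize_le_iff p s C ω k).2 ⟨k, le_rfl, hC⟩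
  rw [h, Nat.cast_le] at this
  exact le_antisymm hk this ▸ hC

lemma Model.isStoppingTime_policySampleSize (m : Model M 𝓧) (p : Fin 2 → ℝ≥0)
    {s : ℕ → (Fin 2 → ℝ≥0) → Fin M} (hs : ∀ n, Measurable (s n))
    {C : ℕ → Set (Fin 2 → ℝ≥0)} (hC : ∀ n, MeasurableSet (C n)) :
    IsStoppingTime (obsFiltration 𝓧) (m.policySampleSize p s C) := by
  intro n
  have : {ω | m.policySampleSize p s C ω ≤ (n : ℕ∞)} =
      ⋃ k ∈ Finset.Iic n, {ω | m.policyState p s k (firstResponses k ω) ∈ C k} := by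
    ext ω
    simp [m.policySampleSize_le_iff p s C ω n]
  refine this ▸ Finset.measurableSet_biUnion _ fun k hk => ?_
  exact (obsFiltration 𝓧).mono (Finset.mem_Iic.1 hk) _
    (((m.measurable_policyState p hs k).comp (measurable_firstResponses_obsFiltration k)) (hC k))

open scoped Classical in
/-- The design that selects experiments by the state-dependent rule `s`, stops on entering `C`, and
makes the Bayes decision. -/
noncomputable def Model.policyDesign (m : Model M 𝓧) (p : Fin 2 → ℝ≥0)
    (s : ℕ → (Fin 2 → ℝ≥0) → Fin M) (hs : ∀ n, Measurable (s n))
    (C : ℕ → Set (Fin 2 → ℝ≥0)) (hC : ∀ n, MeasurableSet (C n)) : Design M 𝓧 where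
  select n y := s n (m.policyState p s n y)
  measurable_select n := (hs n).comp (m.measurable_policyState p hs n)
  sampleSize := m.policySampleSize p s C
  isStoppingTime := m.isStoppingTime_policySampleSize p hs hC
  -- On `{N = ∞}` no such `n` exists and the decision defaults to 0.
  decision ω := if ∃ n : ℕ, m.policySampleSize p s C ω = n ∧
    m.policyState p s n (firstResponses n ω) 0 ≤ m.policyState p s n (firstResponses n ω) 1
    then 1 else 0
  measurable_decision := by
    have hτ := m.isStoppingTime_policySampleSize p hs hC
    refine Measurable.ite ?_ measurable_const measurable_const
    have hk : ∀ k : ℕ, MeasurableSet[obsFiltration 𝓧 k]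
        {ω | m.policySampleSize p s C ω = k ∧ m.policyState p s k (firstResponses k ω) 0 ≤
          m.policyState p s k (firstResponses k ω) 1} := fun k => by
      have hu := (m.measurable_policyState p hs k).comp
        (measurable_firstResponses_obsFiltration k)
      have hle : MeasurableSet {u : Fin 2 → ℝ≥0 | u 0 ≤ u 1} :=
        measurableSet_le (measurable_pi_apply 0) (measurable_pi_apply 1)
      exact (hτ.measurableSet_eq k).inter (hu hle)
    -- Membership in the σ-algebra at the stopping time has two parts: measurability for the
    -- supremum of the filtration, and for each `i` measurability at time `i` of the trace on `{N ≤
    -- i}`.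
    refine ⟨?_, fun i => ?_⟩
    · simp only [Set.ofPred_exists]
      exact MeasurableSet.iUnion fun k => le_iSup (fun t => (obsFiltration 𝓧) t) k _ (hk k)
    · have : {ω | ∃ n : ℕ, m.policySampleSize p s C ω = n ∧
          m.policyState p s n (firstResponses n ω) 0 ≤
            m.policyState p s n (firstResponses n ω) 1} ∩
          {ω | m.policySampleSize p s C ω ≤ (i : ℕ∞)} =
          ⋃ k ∈ Finset.Iic i, {ω | m.policySampleSize p s C ω = k ∧
            m.policyState p s k (firstResponses k ω) 0 ≤
              m.policyState p s k (firstResponses k ω) 1} := by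
        ext ω
        simp only [Set.mem_inter_iff, Set.mem_ofPred_eq, Set.mem_iUnion, Finset.mem_Iic,
          exists_prop]
        constructor
        · rintro ⟨⟨k, hk, h⟩, hi⟩
          exact ⟨k, Nat.cast_le.1 (hk ▸ hi), hk, h⟩
        · rintro ⟨k, hki, hk, h⟩
          exact ⟨⟨k, hk, h⟩, hk ▸ Nat.cast_le.2 hki⟩
      refine this ▸ Finset.measurableSet_biUnion _ fun k hk' => ?_
      exact (obsFiltration 𝓧).mono (Finset.mem_Iic.1 hk') _ (hk k)

/-- `policyState` exists because the stopping time and decision must be defined before there is a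
design to take the posterior of; the two notions agree. -/
lemma Model.state_policyDesign (m : Model M 𝓧) (p : Fin 2 → ℝ≥0)
    {s : ℕ → (Fin 2 → ℝ≥0) → Fin M} (hs : ∀ n, Measurable (s n))
    {C : ℕ → Set (Fin 2 → ℝ≥0)} (hC : ∀ n, MeasurableSet (C n)) (n : ℕ) :
    (m.policyDesign p s hs C hC).state m p n = m.policyState p s n := by
  induction n with
  | zero => rfl
  | succ n ih =>
    funext y
    simp only [Design.state, ih]
    rfl

lemma Model.decision_policyDesign (m : Model M 𝓧) (p : Fin 2 → ℝ≥0)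
    {s : ℕ → (Fin 2 → ℝ≥0) → Fin M} (hs : ∀ n, Measurable (s n))
    {C : ℕ → Set (Fin 2 → ℝ≥0)} (hC : ∀ n, MeasurableSet (C n)) (n : ℕ) (ω : ℕ → 𝓧)
    (h : m.policySampleSize p s C ω = n) :
    (m.policyDesign p s hs C hC).decision ω = 1 ↔
      m.policyState p s n (firstResponses n ω) 0 ≤ m.policyState p s n (firstResponses n ω) 1 := by
  simp only [Model.policyDesign]
  constructor
  · intro h1
    split_ifs at h1 with h2
    · obtain ⟨k, hk, hle⟩ := h2
      obtain rfl : k = n := Nat.cast_injective (R := ℕ∞) (hk.symm.trans h)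
      exact hle
    · simp at h1
  · exact fun hle => if_pos ⟨n, h, hle⟩

/-- Existence of a design following a supersolution `W` of the optimality equation and stopping as
soon as `W` equals the stopping loss. -/
lemma Model.exists_policy (m : Model M 𝓧) [Nonempty (Fin M)] (p : Fin 2 → ℝ≥0) (c : ℝ≥0∞)
    {W : ℕ → (Fin 2 → ℝ≥0) → ℝ≥0∞} (hW : ∀ n, Measurable (W n))
    (hsuper : ∀ n u, min (stopLoss u) (⨅ δ, m.continueLoss c (W (n + 1)) δ u) ≤ W n u ∨
      stopLoss u ≤ W n u) :
    ∃ d : Design M 𝓧, (∀ n : ℕ, stopLoss ≤ W n → ∀ ω, d.sampleSize ω ≤ n) ∧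
      ∑' n, d.stageLoss m p c n ≤ W 0 p ∧
      ((∀ θ, d.law m θ {ω | d.sampleSize ω = ⊤} = 0) → d.risk m p c ≤ W 0 p) := by
  choose s hs hmin using fun n =>
    exists_measurable_argmin fun δ => m.measurable_continueLoss c (hW (n + 1)) δ
  let C : ℕ → Set (Fin 2 → ℝ≥0) := fun n => {u | stopLoss u ≤ W n u}
  have hC : ∀ n, MeasurableSet (C n) := fun n => measurableSet_le measurable_stopLoss (hW n)
  let d := m.policyDesign p s hs C hC
  -- This bound precedes any knowledge that `N` is finite, so it can be used to establish finite
  -- means.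
  have hsum : ∑' n, d.stageLoss m p c n ≤ W 0 p := by
    refine d.tsum_stageLoss_le m p c hW (fun n ω hω => ?_) fun n ω hω => ?_
    · rw [m.state_policyDesign]
      exact m.mem_of_policySampleSize_eq hω
    · rw [m.state_policyDesign]
      -- Before stopping, the state lies outside `C n`, so the minimum in `hsuper` must come from
      -- continuation.
      have hu : ¬ stopLoss (m.policyState p s n (firstResponses n ω)) ≤
          W n (m.policyState p s n (firstResponses n ω)) := fun h =>
        not_le.2 hω ((m.policySampleSize_le_iff p s C ω n).2 ⟨n, le_rfl, h⟩)
      have h1 := (min_le_iff.1 ((hsuper n _).resolve_right hu)).resolve_left hu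
      exact (le_iInf fun δ => hmin n _ δ).trans h1
  refine ⟨d, fun n hn ω => (m.policySampleSize_le_iff p s C ω n).2 ⟨n, le_rfl, hn _⟩, hsum,
    fun hN => (d.risk_le_tsum_stageLoss m p c hN fun n ω hω => ?_).trans hsum⟩
  rw [m.state_policyDesign]
  exact m.decision_policyDesign p hs hC n ω hω

/-! ### Optimal truncated and unrestricted risks -/

lemma Design.law_sampleSize_eq_top (d : Design M 𝓧) (m : Model M 𝓧) (θ : Fin 2)
    (h : d.meanSampleSize m θ ≠ ∞) : d.law m θ {ω | d.sampleSize ω = ⊤} = 0 := by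
  have hz : ⨅ n : ℕ, d.law m θ {ω | (n : ℕ∞) < d.sampleSize ω} = 0 := by
    rw [d.meanSampleSize_eq_tsum] at h
    refine le_antisymm ?_ zero_le
    exact ge_of_tendsto' (ENNReal.tendsto_atTop_zero_of_tsum_ne_top h) fun n => iInf_le _ n
  refine le_antisymm (hz ▸ le_iInf fun n => measure_mono fun ω hω => ?_) zero_le
  simp only [Set.mem_ofPred_eq] at hω ⊢
  rw [hω]
  exact ENat.natCast_lt_top n

lemma truncatedDesigns_subset_finiteMeanDesigns (m : Model M 𝓧) (T : ℕ) :
    truncatedDesigns M 𝓧 T ⊆ finiteMeanDesigns m := by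
  intro d hd θ
  refine (lintegral_mono (g := fun _ => (T : ℝ≥0∞)) fun ω => ?_).trans_lt ?_
  · exact (ENat.toENNReal_le.2 (hd ω)).trans (ENat.toENNReal_coe T).le
  · simp

lemma Model.isLeast_truncatedValue (m : Model M 𝓧) [Nonempty (Fin M)] (p : Fin 2 → ℝ≥0)
    (c : ℝ≥0∞) (T : ℕ) :
    IsLeast ((fun d : Design M 𝓧 => d.risk m p c) '' truncatedDesigns M 𝓧 T)
      (m.truncatedValue c T p) := by
  -- Backward induction: `T - n` observations remain at time `n`. From time `T` on, truncated
  -- subtraction gives `W n = stopLoss`, which forces the policy to stop by `T`.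
  let W : ℕ → (Fin 2 → ℝ≥0) → ℝ≥0∞ := fun n => m.truncatedValue c (T - n)
  have hW : ∀ n, Measurable (W n) := fun n => m.measurable_truncatedValue c _
  have hrec : ∀ n < T, ∀ u, W n u =
      min (stopLoss u) (⨅ δ, m.continueLoss c (W (n + 1)) δ u) := fun n hn u => by
    have : T - n = T - (n + 1) + 1 := by omega
    simp only [W]
    rw [this]
    rfl
  have htop : ∀ d ∈ truncatedDesigns M 𝓧 T, ∀ θ, d.law m θ {ω | d.sampleSize ω = ⊤} = 0 :=
    fun d hd θ => d.law_sampleSize_eq_top m θ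
      (truncatedDesigns_subset_finiteMeanDesigns m T hd θ).ne
  have hlow : ∀ d ∈ truncatedDesigns M 𝓧 T, m.truncatedValue c T p ≤ d.risk m p c := by
    intro d hd
    refine d.le_risk m p c hW (fun n u => m.truncatedValue_le_stopLoss c _ u) ?_ (htop d hd 0)
    rintro n ⟨ω, hω⟩ δ u
    have hn : n < T := Nat.cast_lt.1 (hω.trans_le (hd ω))
    rw [hrec n hn]
    exact (min_le_right _ _).trans (iInf_le _ δ)
  refine ⟨?_, by rintro _ ⟨d, hd, rfl⟩; exact hlow d hd⟩
  obtain ⟨d, hd, -, hrisk⟩ := m.exists_policy p c hW fun n u => by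
    rcases lt_or_ge n T with hn | hn
    · exact Or.inl (hrec n hn u).ge
    · refine Or.inr ?_
      simp only [W, Nat.sub_eq_zero_of_le hn]
      exact le_rfl
  have hdT : d ∈ truncatedDesigns M 𝓧 T := fun ω => hd T (by
    simp only [W, Nat.sub_self]
    exact le_rfl) ω
  exact ⟨d, hdT, le_antisymm (hrisk (htop d hdT)) (hlow d hdT)⟩

lemma Model.value_le_risk (m : Model M 𝓧) (p : Fin 2 → ℝ≥0) (c : ℝ≥0∞) {d : Design M 𝓧}
    (hd : d ∈ finiteMeanDesigns m) : m.value c p ≤ d.risk m p c :=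
  d.le_risk m p c (W := fun _ => m.value c) (fun _ => m.measurable_value c)
    (fun _ u => m.value_le_stopLoss c u) (fun _ _ δ u => m.value_le_continueLoss c δ u)
    (d.law_sampleSize_eq_top m 0 (hd 0).ne)

/-- Each truncated value is attained by a finite-mean design, so every lower bound of the risks lies
below all of them and hence below their infimum. -/
lemma Model.isGLB_value (m : Model M 𝓧) [Nonempty (Fin M)] (p : Fin 2 → ℝ≥0) (c : ℝ≥0∞) :
    IsGLB ((fun d : Design M 𝓧 => d.risk m p c) '' finiteMeanDesigns m) (m.value c p) := by
  refine ⟨by rintro _ ⟨d, hd, rfl⟩; exact m.value_le_risk p c hd, fun b hb => le_iInf fun T => ?_⟩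
  exact hb (Set.image_mono (truncatedDesigns_subset_finiteMeanDesigns m T)
    (m.isLeast_truncatedValue p c T).1)

lemma Model.isLeast_value (m : Model M 𝓧) [Nonempty (Fin M)] (p : Fin 2 → ℝ≥0) {c : ℝ≥0∞}
    (hc : c ≠ 0) :
    IsLeast ((fun d : Design M 𝓧 => d.risk m p c) '' finiteMeanDesigns m) (m.value c p) := by
  refine ⟨?_, (m.isGLB_value p c).1⟩
  -- With a zero prior weight, the weighted cost says nothing about the mean under that label, so
  -- the policy induced by `value` might leave the class; stopping at once has risk 0 instead.
  by_cases hp : ∃ θ, p θ = 0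
  · obtain ⟨d, hd, hr⟩ := (m.isLeast_truncatedValue p c 0).1
    have hd' := truncatedDesigns_subset_finiteMeanDesigns m 0 hd
    refine ⟨d, hd', le_antisymm ?_ (m.value_le_risk p c hd')⟩
    have h0 : stopLoss p = 0 := by
      obtain ⟨θ, hθ⟩ := hp
      fin_cases θ <;> simp_all [stopLoss]
    exact (hr.trans h0).le.trans zero_le
  · push Not at hp
    obtain ⟨d, -, hsum, hrisk⟩ := m.exists_policy p c (W := fun _ => m.value c)
      (fun _ => m.measurable_value c) fun _ u => Or.inl (m.min_le_value c u)
    -- The sampling cost is part of the total stage loss, which is at most `value ≤ p 0 < ∞`;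
    -- dividing by `c` and by the prior weights gives finite means.
    have hmean : c * (p 0 * d.meanSampleSize m 0 + p 1 * d.meanSampleSize m 1) ≠ ∞ := by
      rw [d.tsum_stageLoss] at hsum
      have h1 : m.value c p < ∞ :=
        ((m.value_le_stopLoss c p).trans (min_le_left _ _)).trans_lt ENNReal.coe_lt_top
      exact (le_add_self.trans hsum |>.trans_lt h1).ne
    have hmean' := ENNReal.add_ne_top.1 ((ENNReal.lt_top_of_mul_ne_top_right hmean hc).ne)
    have hd : d ∈ finiteMeanDesigns m := fun θ => by
      have h : p θ * d.meanSampleSize m θ ≠ ∞ := by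
        fin_cases θ
        exacts [hmean'.1, hmean'.2]
      exact ENNReal.lt_top_of_mul_ne_top_right h (ENNReal.coe_ne_zero.2 (hp θ))
    exact ⟨d, hd, le_antisymm (hrisk fun θ => d.law_sampleSize_eq_top m θ (hd θ).ne)
      (m.value_le_risk p c hd)⟩

lemma Model.tendsto_truncatedValue (m : Model M 𝓧) (p : Fin 2 → ℝ≥0) (c : ℝ≥0∞) :
    Tendsto (fun T => m.truncatedValue c T p) atTop (𝓝 (m.value c p)) :=
  tendsto_atTop_iInf fun _ _ h => m.truncatedValue_antitone c h p

end

end AdaSPRT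

theorem mainTheorem3 {M d : ℕ} (hM : 0 < M)
    (m : AdaSPRT.Model M (EuclideanSpace ℝ (Fin d)))
    (π₀ π₁ c : ℝ) (hπ₀ : 0 ≤ π₀) (hπ₁ : 0 ≤ π₁) (hπ : π₀ + π₁ = 1) (hc₀ : 0 ≤ c) (hc₁ : c ≤ 1) :
    ∃ (r : ℕ → ℝ≥0∞) (rStar : ℝ≥0∞),
      (∀ T, IsLeast (AdaSPRT.designRisk m π₀ π₁ c ''
        AdaSPRT.truncatedDesigns M (EuclideanSpace ℝ (Fin d)) T) (r T)) ∧
      IsGLB (AdaSPRT.designRisk m π₀ π₁ c '' AdaSPRT.finiteMeanDesigns m) rStar ∧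
      (0 < c → IsLeast (AdaSPRT.designRisk m π₀ π₁ c '' AdaSPRT.finiteMeanDesigns m) rStar) ∧
      Tendsto r atTop (𝓝 rStar) := by
  have : Nonempty (Fin M) := ⟨⟨0, hM⟩⟩
  let p : Fin 2 → ℝ≥0 := ![π₀.toNNReal, π₁.toNNReal]
  let c' : ℝ≥0∞ := ENNReal.ofReal c
  -- `ENNReal.ofReal` is by definition the coercion of `Real.toNNReal`, so the two risks agree
  -- definitionally.
  have hrisk : AdaSPRT.designRisk m π₀ π₁ c = fun d => d.risk m p c' := rfl
  rw [hrisk]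
  exact ⟨fun T => m.truncatedValue c' T p, m.value c' p, m.isLeast_truncatedValue p c',
    m.isGLB_value p c', fun hc => m.isLeast_value p (ENNReal.ofReal_pos.2 hc).ne',
    m.tendsto_truncatedValue p c'⟩
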